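/- Let $k$ be a field, let $n\ge 1$ and $d\ge 0$ be integers, and let $A=k[x_1,\dots,x_d]$. Let $g\in A$ be a weighted homogeneous polynomial whose degree is relatively prime to $n$; that is, there is an $\mathbb N$-grading on the $k$-algebra $A$ with $A_0=k$ for which $g$ is homogeneous of some degree $m$ with $\gcd(m,n)=1$. Assume that the hypersurface ring $$R=k[z,x_1,\dots,x_d]/(z^n-g)$$ is a normal domain, and let $g=h_1\cdots h_r$, where the $h_i\in A$ are irreducible polynomials. Let $\operatorname{Cl}(R)$ be the divisor class group of $R$, i.e. the free abelian group on the height one prime ideals of $R$ modulo the subgroup of principal divisors $\operatorname{div}(f)=\sum_P \operatorname{ord}_P(f)\,P$, $f\in\operatorname{Frac}(R)^\times$. Then $$\operatorname{Cl}(R)\cong(\mathbb Z/n\mathbb Z)^{r-1}$$ (for $r=0$, which can occur only when $n=1$, the right-hand side is read as $0$). Each ideal $(z,h_i)R$, $1\le i\le r$, is a prime ideal of height one, and the classes of $(z,h_1),\dots,(z,h_{r-1})$ generate $\operatorname{Cl}(R)$. If $n\ge 2$, they form a minimal generating set of $\operatorname{Cl}(R)$: no proper subfamily of these $r-1$ classes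 generates $\operatorname{Cl}(R)$. -/

import Mathlib

/-- The height-one prime ideals of `R`, i.e. the prime divisors of `Spec R`. -/
structure PrimeDivisor (R : Type*) [CommRing R] where
  /-- the underlying ideal -/
  asIdeal : Ideal R
  isPrime : asIdeal.IsPrime
  height_eq_one : asIdeal.height = 1

namespace PrimeDivisor

variable {R : Type*} [CommRing R]

instance (P : PrimeDivisor R) : P.asIdeal.IsPrime := P.isPrime

theorem ext_asIdeal {P Q : PrimeDivisor R} (h : P.asIdeal = Q.asIdeal) : P = Q := by
  cases P; cases Q; cases h; rfl

instance krullDimLE (P : PrimeDivisor R) :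
    Ring.KrullDimLE 1 (Localization.AtPrime P.asIdeal) := by
  rw [Ring.krullDimLE_iff,
    IsLocalization.AtPrime.ringKrullDim_eq_height P.asIdeal (Localization.AtPrime P.asIdeal),
    P.height_eq_one]
  rfl

/-- The order of vanishing of `a : R` along `P`: the length of `R_P / a R_P`. When `R` is a
Noetherian normal domain, `R_P` is a discrete valuation ring and this is the normalized
valuation of `a`. It is used for `a ≠ 0` only. -/
noncomputable def ord (P : PrimeDivisor R) (a : R) : ℕ :=
  (Ring.ord (Localization.AtPrime P.asIdeal)
    (algebraMap R (Localization.AtPrime P.asIdeal) a)).toNat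

variable [IsDomain R]

theorem algebraMap_mem_nonZeroDivisors (P : PrimeDivisor R) {a : R} (ha : a ≠ 0) :
    algebraMap R (Localization.AtPrime P.asIdeal) a ∈
      nonZeroDivisors (Localization.AtPrime P.asIdeal) := by
  apply mem_nonZeroDivisors_of_ne_zero
  rwa [Ne, IsLocalization.to_map_eq_zero_iff (M := P.asIdeal.primeCompl) _
    P.asIdeal.primeCompl_le_nonZeroDivisors]

variable [IsNoetherianRing R]

theorem ord_mul (P : PrimeDivisor R) {a b : R} (ha : a ≠ 0) (hb : b ≠ 0) :
    P.ord (a * b) = P.ord a + P.ord b := by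
  have ha' := P.algebraMap_mem_nonZeroDivisors ha
  have hb' := P.algebraMap_mem_nonZeroDivisors hb
  rw [ord, map_mul, Ring.ord_mul _ hb', ENat.toNat_add (Ring.ord_ne_top ha') (Ring.ord_ne_top hb')]
  rfl

/-- A nonzero element vanishes along finitely many prime divisors only. -/
theorem finite_ord_ne_zero {a : R} (ha : a ≠ 0) :
    {P : PrimeDivisor R | P.ord a ≠ 0}.Finite := by
  have hfin := Ideal.finite_minimalPrimes_of_isNoetherianRing R (Ideal.span {a})
  refine Set.Finite.of_finite_image (f := PrimeDivisor.asIdeal) (hfin.subset ?_)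
    (fun P _ Q _ h => ext_asIdeal h)
  rintro _ ⟨P, hP, rfl⟩
  have haP : a ∈ P.asIdeal := by
    by_contra h
    refine hP ?_
    have hu : IsUnit (algebraMap R (Localization.AtPrime P.asIdeal) a) :=
      IsLocalization.map_units _ (⟨a, h⟩ : P.asIdeal.primeCompl)
    simp [ord, Ring.ord_of_isUnit hu]
  refine ⟨⟨P.isPrime, (Ideal.span_singleton_le_iff_mem _).2 haP⟩, ?_⟩
  rintro Q ⟨hQ, haQ⟩ hQP
  by_contra hne
  have hlt : Q < P.asIdeal := lt_of_le_not_ge hQP hne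
  have h0 : Q.height = 0 := by
    have := Ideal.height_le_iff (p := P.asIdeal) (n := 1) |>.1 (by rw [P.height_eq_one]; rfl)
      Q hQ hlt
    simpa using this
  rw [Ideal.height_eq_zero_iff_eq_bot] at h0
  subst h0
  exact ha (by simpa using haQ)

end PrimeDivisor

section DivisorClassGroup

variable (R : Type*) [CommRing R] [IsDomain R] [IsNoetherianRing R]

/-- The group of Weil divisors of `R`: the free abelian group on the height-one primes. -/
abbrev WeilDivisor (R : Type*) [CommRing R] : Type _ := PrimeDivisor R →₀ ℤ

variable {R} in
/-- The divisor `∑ ord_P(a) P` of a nonzero element `a` of `R`. -/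
noncomputable def WeilDivisor.div (a : R) (ha : a ≠ 0) : WeilDivisor R :=
  Finsupp.ofSupportFinite (fun P => (P.ord a : ℤ))
    ((PrimeDivisor.finite_ord_ne_zero ha).subset fun P hP => by simpa using hP)

variable {R} in
theorem WeilDivisor.div_mul (a b : R) (ha : a ≠ 0) (hb : b ≠ 0) :
    WeilDivisor.div (a * b) (mul_ne_zero ha hb) = WeilDivisor.div a ha + WeilDivisor.div b hb := by
  ext P
  simp [WeilDivisor.div, Finsupp.ofSupportFinite_coe, P.ord_mul ha hb]

/-- The subgroup of principal divisors `div(a/b) = div(a) - div(b)`, where `a/b` runs through the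
nonzero elements of the fraction field of `R`. -/
def principalDivisors : AddSubgroup (WeilDivisor R) where
  carrier := {D | ∃ (a b : R) (ha : a ≠ 0) (hb : b ≠ 0),
    D = WeilDivisor.div a ha - WeilDivisor.div b hb}
  zero_mem' := ⟨1, 1, one_ne_zero, one_ne_zero, by simp⟩
  add_mem' := by
    rintro _ _ ⟨a, b, ha, hb, rfl⟩ ⟨c, d, hc, hd, rfl⟩
    refine ⟨a * c, b * d, mul_ne_zero ha hc, mul_ne_zero hb hd, ?_⟩
    rw [WeilDivisor.div_mul a c ha hc, WeilDivisor.div_mul b d hb hd]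
    abel
  neg_mem' := by
    rintro _ ⟨a, b, ha, hb, rfl⟩
    exact ⟨b, a, hb, ha, by abel⟩

/-- The divisor class group `Cl(R)`: Weil divisors modulo principal divisors. -/
abbrev DivisorClassGroup : Type _ := WeilDivisor R ⧸ principalDivisors R

variable {R} in
/-- The class in `Cl(R)` of a height-one prime. -/
noncomputable def PrimeDivisor.toClass (P : PrimeDivisor R) : DivisorClassGroup R :=
  QuotientAddGroup.mk (Finsupp.single P 1)

end DivisorClassGroup

/-- The ring `k[z, x₁, …, x_d] / (zⁿ - g)` with `g ∈ k[x₁, …, x_d]`, where `k[z, x₁, …, x_d]` is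
written as the polynomial ring in `z` over `k[x₁, …, x_d]`. -/
abbrev Hypersurface {k : Type*} [Field k] {d : ℕ} (n : ℕ) (g : MvPolynomial (Fin d) k) : Type _ :=
  Polynomial (MvPolynomial (Fin d) k) ⧸ Ideal.span {Polynomial.X ^ n - Polynomial.C g}

namespace Hypersurface

variable {k : Type*} [Field k] {d : ℕ} (n : ℕ) (g : MvPolynomial (Fin d) k)

/-- The image of `z` in `k[z, x₁, …, x_d] / (zⁿ - g)`. -/
noncomputable def z : Hypersurface n g :=
  Ideal.Quotient.mk _ Polynomial.X

/-- The natural ring homomorphism from `k[x₁, …, x_d]` to `k[z, x₁, …, x_d] / (zⁿ - g)`. -/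
noncomputable def of : MvPolynomial (Fin d) k →+* Hypersurface n g :=
  (Ideal.Quotient.mk _).comp Polynomial.C

end Hypersurface

open IsLocalRing in
/-- In a Noetherian integrally closed local domain, the maximal ideal is principal as soon as it is
the annihilator of an element modulo a nonzero principal ideal. -/
theorem IsLocalRing.maximalIdeal_isPrincipal_of_mul_mem_span {L : Type*} [CommRing L] [IsDomain L]
    [IsLocalRing L] [IsNoetherianRing L] [IsIntegrallyClosed L] {a b : L} (ha : a ≠ 0)
    (ham : a ∈ maximalIdeal L) (hb : b ∉ Ideal.span {a})
    (hbm : ∀ x ∈ maximalIdeal L, ∃ y, y * a = b * x) : (maximalIdeal L).IsPrincipal := by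
  have hb0 : b ≠ 0 := by rintro rfl; exact hb (zero_mem _)
  let K := FractionRing L
  let x : K := algebraMap L K b / algebraMap L K a
  let M := Submodule.map (Algebra.linearMap L K) (maximalIdeal L)
  have ha' : algebraMap L K a ≠ 0 := IsFractionRing.to_map_eq_zero_iff.not.mpr ha
  have key : ∀ c ∈ maximalIdeal L, ∀ y, y * a = b * c →
      x * algebraMap L K c = algebraMap L K y := by
    intro c _ y hy
    rw [← mul_div_right_comm, ← map_mul, ← hy, map_mul, mul_div_cancel_right₀ _ ha']
  by_cases hx : ∀ y ∈ M, x * y ∈ M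
  · exfalso
    have hint := isIntegral_of_smul_mem_submodule M
      ((Submodule.ne_bot_iff _).2 ⟨_, ⟨a, ham, rfl⟩, ha'⟩)
      (Submodule.FG.map _ (IsNoetherian.noetherian _)) x hx
    obtain ⟨y, e⟩ := IsIntegrallyClosed.algebraMap_eq_of_integral hint
    refine hb (Ideal.mem_span_singleton'.mpr ⟨y, IsFractionRing.injective L K ?_⟩)
    rw [map_mul, e, div_mul_cancel₀ _ ha']
  · push Not at hx
    obtain ⟨_, ⟨c, hc, rfl⟩, hcx⟩ := hx
    obtain ⟨y, hy⟩ := hbm c hc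
    have hyu : IsUnit y := by
      by_contra hyu
      exact hcx ⟨y, (mem_maximalIdeal _).2 hyu, (key c hc y hy).symm⟩
    refine ⟨⟨c, le_antisymm (fun w hw => ?_) ?_⟩⟩
    · obtain ⟨v, hv⟩ := hbm w hw
      have h1 : b * (y * w) = b * (v * c) := by
        linear_combination v * hy - y * hv
      have h2 := mul_left_cancel₀ hb0 h1
      have h3 : c ∣ y * w := ⟨v, by rw [h2, mul_comm]⟩
      exact Ideal.mem_span_singleton.2 (hyu.dvd_mul_left.1 h3)
    · exact (Ideal.span_singleton_le_iff_mem _).2 hc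

namespace PrimeDivisor

variable {R : Type*} [CommRing R]

theorem ne_bot (P : PrimeDivisor R) [IsDomain R] : P.asIdeal ≠ ⊥ := by
  intro h
  have := P.height_eq_one
  rw [h, Ideal.height_bot] at this
  exact zero_ne_one this

theorem eq_of_le [IsDomain R] {Q : PrimeDivisor R} {I : Ideal R} [I.IsPrime] (hI : I ≠ ⊥)
    (h : I ≤ Q.asIdeal) : I = Q.asIdeal := by
  by_contra hne
  have := Ideal.height_le_iff (p := Q.asIdeal) (n := 1) |>.1 (by rw [Q.height_eq_one]; rfl)
    I inferInstance (lt_of_le_of_ne h hne)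
  have h0 : I.height = 0 := by simpa using this
  exact hI ((Ideal.height_eq_zero_iff_eq_bot).1 h0)

theorem ord_eq_zero {P : PrimeDivisor R} {a : R} (h : a ∉ P.asIdeal) : P.ord a = 0 := by
  have hu : IsUnit (algebraMap R (Localization.AtPrime P.asIdeal) a) :=
    IsLocalization.map_units _ (⟨a, h⟩ : P.asIdeal.primeCompl)
  simp [ord, Ring.ord_of_isUnit hu]

/-- A local generator of `P` vanishes along `P` to order one. -/
theorem ord_eq_one {P : PrimeDivisor R} {a : R} (ha : a ∈ P.asIdeal)
    (h : ∀ q ∈ P.asIdeal, ∃ s ∉ P.asIdeal, a ∣ s * q) : P.ord a = 1 := by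
  let L := Localization.AtPrime P.asIdeal
  have hspan : Ideal.span {algebraMap R L a} = IsLocalRing.maximalIdeal L := by
    rw [← Localization.AtPrime.map_eq_maximalIdeal]
    refine le_antisymm ((Ideal.span_singleton_le_iff_mem _).2 (Ideal.mem_map_of_mem _ ha)) ?_
    rw [Ideal.map_le_iff_le_comap]
    intro q hq
    obtain ⟨s, hs, hd⟩ := h q hq
    have hu : IsUnit (algebraMap R L s) :=
      IsLocalization.map_units _ (⟨s, hs⟩ : P.asIdeal.primeCompl)
    have := map_dvd (algebraMap R L) hd
    rw [map_mul, hu.dvd_mul_left] at this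
    exact Ideal.mem_span_singleton.2 this
  have h1 : Ring.ord L (algebraMap R L a) = 1 := by
    rw [Ring.ord, Module.length_eq_one_iff, hspan, isSimpleModule_iff_quot_maximal]
    exact ⟨_, inferInstance, ⟨LinearEquiv.refl _ _⟩⟩
  rw [ord, h1]
  rfl

variable [IsDomain R] [IsNoetherianRing R]

theorem ord_pow (P : PrimeDivisor R) {a : R} (ha : a ≠ 0) (j : ℕ) :
    P.ord (a ^ j) = j * P.ord a := by
  induction j with
  | zero =>
    rw [pow_zero, zero_mul]
    exact ord_eq_zero ((Ideal.ne_top_iff_one _).1 P.isPrime.ne_top)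
  | succ j ih => rw [pow_succ, P.ord_mul (pow_ne_zero _ ha) ha, ih]; ring

theorem dvd_of_ord_le (P : PrimeDivisor R)
    [ValuationRing (Localization.AtPrime P.asIdeal)] {a b : R} (ha : a ≠ 0)
    (hb : b ≠ 0) (h : P.ord b ≤ P.ord a) :
    algebraMap R (Localization.AtPrime P.asIdeal) b ∣ algebraMap R _ a := by
  set L := Localization.AtPrime P.asIdeal
  have ha' := P.algebraMap_mem_nonZeroDivisors ha
  have hb' := P.algebraMap_mem_nonZeroDivisors hb
  rcases ValuationRing.dvd_total (algebraMap R L b) (algebraMap R L a) with hd | ⟨c, hc⟩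
  · exact hd
  have hle : Ring.ord L (algebraMap R L b) ≤ Ring.ord L (algebraMap R L a) := by
    rw [← ENat.natCast_toNat (Ring.ord_ne_top hb'), ← ENat.natCast_toNat (Ring.ord_ne_top ha')]
    exact_mod_cast h
  rw [hc, Ring.ord_mul' L ha'] at hle
  have hc0 : Ring.ord L c = 0 := by
    rw [← nonpos_iff_eq_zero]
    refine (ENat.add_le_add_iff_left (Ring.ord_ne_top ha')).1 ?_
    rwa [add_zero]
  rw [Ring.ord, Module.length_eq_zero_iff, Submodule.Quotient.subsingleton_iff,
    Ideal.span_singleton_eq_top] at hc0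
  exact hc ▸ hc0.mul_right_dvd.2 dvd_rfl

end PrimeDivisor

/-- In a Noetherian integrally closed domain, divisibility can be tested on orders of vanishing
along the height-one primes. -/
theorem dvd_of_forall_ord_le {R : Type*} [CommRing R] [IsDomain R] [IsNoetherianRing R]
    [IsIntegrallyClosed R] {a b : R} (ha : a ≠ 0) (hb : b ≠ 0)
    (h : ∀ P : PrimeDivisor R, P.ord b ≤ P.ord a) : b ∣ a := by
  by_contra hdvd
  have hx : (Ideal.Quotient.mk (Ideal.span {b}) a) ≠ 0 := by
    rwa [Ne, Ideal.Quotient.eq_zero_iff_mem, Ideal.mem_span_singleton]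
  obtain ⟨P, hP, haP⟩ := exists_le_isAssociatedPrime_of_isNoetherianRing R _ hx
  rw [isAssociatedPrime_iff] at hP
  obtain ⟨hPp, y, hy⟩ := hP
  obtain ⟨c, rfl⟩ := Ideal.Quotient.mk_surjective y
  have hcolon : ∀ u v : R, u ∈ (⊥ : Submodule R (R ⧸ Ideal.span {b})).colon
      {Ideal.Quotient.mk (Ideal.span {b}) v} ↔ b ∣ u * v := by
    intro u v
    rw [Submodule.mem_colon_singleton, Submodule.mem_bot, ← Ideal.mem_span_singleton,
      ← Ideal.Quotient.eq_zero_iff_mem, map_mul]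
    rfl
  have hPc : ∀ u, u ∈ P ↔ b ∣ u * c := fun u => by rw [hy, hcolon]
  let L := Localization.AtPrime P
  have hinj : Function.Injective (algebraMap R L) :=
    IsLocalization.injective L P.primeCompl_le_nonZeroDivisors
  have hbP : b ∈ P := (hPc b).2 (dvd_mul_right _ _)
  have hb' : algebraMap R L b ≠ 0 := by rwa [Ne, map_eq_zero_iff _ hinj]
  have hbm : algebraMap R L b ∈ IsLocalRing.maximalIdeal L := by
    rw [← Localization.AtPrime.map_eq_maximalIdeal]
    exact Ideal.mem_map_of_mem _ hbP
  have hlocal : ∀ u, algebraMap R L b ∣ algebraMap R L u → ∃ s ∉ P, b ∣ s * u := by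
    rintro u ⟨w, hw⟩
    obtain ⟨⟨x, s⟩, hxs⟩ := IsLocalization.surj P.primeCompl w
    refine ⟨s, s.2, x, hinj ?_⟩
    simp only [map_mul]
    rw [hw, ← hxs]
    ring
  have hprin : (IsLocalRing.maximalIdeal L).IsPrincipal := by
    have : IsIntegrallyClosed L :=
      isIntegrallyClosed_of_isLocalization L P.primeCompl P.primeCompl_le_nonZeroDivisors
    have : IsNoetherianRing L := IsLocalization.isNoetherianRing P.primeCompl L inferInstance
    refine IsLocalRing.maximalIdeal_isPrincipal_of_mul_mem_span (b := algebraMap R L c) hb' hbm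
      ?_ ?_
    · intro hmem
      obtain ⟨s, hs, hd⟩ := hlocal c (Ideal.mem_span_singleton.1 hmem)
      exact hs ((hPc s).2 hd)
    · intro x hx
      obtain ⟨⟨u, s⟩, hus⟩ := IsLocalization.surj P.primeCompl x
      have hu : u ∈ P := by
        rw [← Localization.AtPrime.under_maximalIdeal (I := P)]
        rw [Ideal.under, Ideal.mem_comap, ← hus]
        exact Ideal.mul_mem_right _ _ hx
      obtain ⟨v, hv⟩ := (hPc u).1 hu
      have hsu : IsUnit (algebraMap R L s) := IsLocalization.map_units _ s
      obtain ⟨t, ht⟩ := hsu.exists_right_inv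
      refine ⟨t * algebraMap R L v, ?_⟩
      have hv' := congrArg (algebraMap R L) hv
      simp only [map_mul] at hv'
      linear_combination (algebraMap R L c * x) * ht - t * hv' - t * algebraMap R L c * hus
  have : IsNoetherianRing L := IsLocalization.isNoetherianRing P.primeCompl L inferInstance
  have hval : ValuationRing L :=
    ((tfae_of_isNoetherianRing_of_isLocalRing_of_isDomain L).out 4 1).1 hprin
  have hle : P.height ≤ 1 := by
    have := Ideal.height_le_one_of_isPrincipal_of_mem_minimalPrimes
      (IsLocalRing.maximalIdeal L) (IsLocalRing.maximalIdeal L)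
      (by rw [Ideal.minimalPrimes_eq_subsingleton_self]; rfl)
    rwa [← IsLocalization.height_under P.primeCompl,
      Localization.AtPrime.under_maximalIdeal] at this
  have hge : P.height ≠ 0 := by
    rw [Ne, Ideal.height_eq_zero_iff_eq_bot]
    rintro rfl
    exact hb (by simpa using hbP)
  let Q : PrimeDivisor R := ⟨P, hPp, le_antisymm hle (Order.one_le_iff_ne_zero.2 hge)⟩
  have : ValuationRing (Localization.AtPrime Q.asIdeal) := hval
  obtain ⟨s, hs, hd⟩ := hlocal a (Q.dvd_of_ord_le ha hb (h Q))
  exact hs (haP ((hcolon s a).2 hd))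

namespace PrimeDivisor

variable {R : Type*} [CommRing R] [IsDomain R] [IsNoetherianRing R]

theorem mk_div (a : R) (ha : a ≠ 0) :
    (QuotientAddGroup.mk (WeilDivisor.div a ha) : DivisorClassGroup R) = 0 := by
  rw [QuotientAddGroup.eq_zero_iff]
  refine ⟨a, 1, ha, one_ne_zero, ?_⟩
  suffices WeilDivisor.div (1 : R) one_ne_zero = 0 by rw [this, sub_zero]
  ext P
  have := P.ord_pow (one_ne_zero (α := R)) 0
  simpa [WeilDivisor.div, Finsupp.ofSupportFinite_coe] using this

theorem toClass_eq_zero (P : PrimeDivisor R) {p : R} (hp : P.asIdeal = Ideal.span {p}) :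
    P.toClass = 0 := by
  have hp0 : p ≠ 0 := by
    rintro rfl
    exact P.ne_bot (by simpa using hp)
  have hpP : p ∈ P.asIdeal := hp ▸ Ideal.mem_span_singleton_self p
  rw [← mk_div p hp0, toClass]
  congr 1
  ext Q
  by_cases hQ : P = Q
  · subst hQ
    have : P.ord p = 1 := ord_eq_one hpP fun q hq =>
      ⟨1, (Ideal.ne_top_iff_one _).1 P.isPrime.ne_top, by
        rw [one_mul]; rwa [hp, Ideal.mem_span_singleton] at hq⟩
    simp [WeilDivisor.div, Finsupp.ofSupportFinite_coe, this]
  · have : Q.ord p = 0 := ord_eq_zero fun hpQ => hQ (ext_asIdeal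
      (eq_of_le P.ne_bot (by rw [hp]; exact (Ideal.span_singleton_le_iff_mem _).2 hpQ)))
    simp [WeilDivisor.div, Finsupp.ofSupportFinite_coe, this, hQ]

end PrimeDivisor

namespace GradedRing

open Polynomial DirectSum

variable {R σ : Type*} [CommRing R] [SetLike σ R] [AddSubmonoidClass σ R]
  (ℬ : ℕ → σ) [GradedRing ℬ]

/-- The ring homomorphism `∑ xᵢ ↦ ∑ xᵢ Tⁱ` from an `ℕ`-graded ring to polynomials over it. -/
noncomputable def toPolynomial : R →+* R[X] :=
  (DirectSum.toSemiring
    (fun i => ((monomial i).toAddMonoidHom : R →+ R[X]).comp (AddSubmonoidClass.subtype (ℬ i)))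
    rfl (fun {i j} x y => (monomial_mul_monomial i j (x : R) (y : R)).symm)).comp
    (decomposeRingEquiv ℬ).toRingHom

theorem toPolynomial_of_mem {i : ℕ} {x : R} (hx : x ∈ ℬ i) :
    toPolynomial ℬ x = monomial i x := by
  lift x to ℬ i using hx
  have h : decomposeRingEquiv ℬ (x : R) = DirectSum.of (fun i => ℬ i) i x := decompose_coe ℬ x
  simp only [toPolynomial, RingHom.comp_apply, RingEquiv.toRingHom_eq_coe, RingHom.coe_coe, h]
  exact DirectSum.toSemiring_of (A := fun i => ℬ i) _ _ _ i x

theorem coeff_toPolynomial (x : R) (i : ℕ) :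
    (toPolynomial ℬ x).coeff i = (decompose ℬ x i : R) := by
  induction x using DirectSum.Decomposition.inductionOn ℬ with
  | zero => simp
  | homogeneous y =>
    rename_i j
    rw [toPolynomial_of_mem ℬ y.2, coeff_monomial, decompose_coe]
    split_ifs with h
    · subst h; simp
    · rw [DirectSum.of_eq_of_ne _ _ _ (Ne.symm h)]; simp
  | add a b ha hb => simp [ha, hb]

theorem coeff_toPolynomial_mem (x : R) (i : ℕ) : (toPolynomial ℬ x).coeff i ∈ ℬ i := by
  rw [coeff_toPolynomial]
  exact SetLike.coe_mem _

theorem toPolynomial_injective : Function.Injective (toPolynomial ℬ) := by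
  intro x y h
  apply (decompose ℬ).injective
  ext i
  rw [← coeff_toPolynomial, h, coeff_toPolynomial]

theorem toPolynomial_ne_zero {x : R} (hx : x ≠ 0) : toPolynomial ℬ x ≠ 0 := by
  rwa [Ne, map_eq_zero_iff _ (toPolynomial_injective ℬ)]

/-- The difference between the highest and the lowest degree of a homogeneous component. -/
noncomputable def width (x : R) : ℕ :=
  (toPolynomial ℬ x).natDegree - (toPolynomial ℬ x).natTrailingDegree

/-- One step of division with remainder, up to homogeneous factors. -/
theorem exists_width_lt {f q : R} (hf : f ≠ 0) (hq : q ≠ 0) (h : width ℬ f ≤ width ℬ q) :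
    ∃ a b : R, SetLike.IsHomogeneousElem ℬ b ∧ b ≠ 0 ∧
      (b * q - a * f = 0 ∨ width ℬ (b * q - a * f) < width ℬ q) := by
  have hF0 := toPolynomial_ne_zero ℬ hf
  have hQ0 := toPolynomial_ne_zero ℬ hq
  set F := toPolynomial ℬ f with hF
  set Q := toPolynomial ℬ q with hQ
  have ha := toPolynomial_of_mem ℬ (coeff_toPolynomial_mem ℬ q Q.natDegree)
  have hb := toPolynomial_of_mem ℬ (coeff_toPolynomial_mem ℬ f F.natDegree)
  rw [← hQ] at ha
  rw [← hF] at hb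
  have hb0 : F.coeff F.natDegree ≠ 0 := leadingCoeff_ne_zero.2 hF0
  refine ⟨Q.coeff Q.natDegree, F.coeff F.natDegree,
    ⟨_, coeff_toPolynomial_mem ℬ f F.natDegree⟩, hb0, or_iff_not_imp_left.2 fun hne => ?_⟩
  have hG0 := toPolynomial_ne_zero ℬ hne
  unfold width at h ⊢
  set G := toPolynomial ℬ (F.coeff F.natDegree * q - Q.coeff Q.natDegree * f) with hG
  have hGe : G = monomial F.natDegree (F.coeff F.natDegree) * Q -
      monomial Q.natDegree (Q.coeff Q.natDegree) * F := by
    rw [hG, map_sub, map_mul, map_mul, ha, hb]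
  rw [← hF, ← hQ] at h
  rw [← hQ]
  have hFt := natTrailingDegree_le_natDegree F
  have hQt := natTrailingDegree_le_natDegree Q
  have hGt := natTrailingDegree_le_natDegree G
  have hcoeff : ∀ j, G.coeff j ≠ 0 → j < F.natDegree + Q.natDegree ∧
      F.natDegree + Q.natTrailingDegree ≤ j := by
    intro j hj
    rw [hGe, coeff_sub, ← C_mul_X_pow_eq_monomial, ← C_mul_X_pow_eq_monomial, mul_assoc, mul_assoc,
      coeff_C_mul, coeff_C_mul, coeff_X_pow_mul', coeff_X_pow_mul'] at hj
    constructor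
    · by_contra hlt
      rw [not_lt] at hlt
      apply hj
      rw [if_pos (by omega), if_pos (by omega)]
      rcases hlt.eq_or_lt with rfl | hlt
      · rw [Nat.add_sub_cancel_left, Nat.add_sub_cancel]; ring
      · rw [coeff_eq_zero_of_natDegree_lt (p := Q) (n := j - F.natDegree) (by omega),
          coeff_eq_zero_of_natDegree_lt (p := F) (n := j - Q.natDegree) (by omega)]
        simp
    · by_contra hlt
      rw [not_le] at hlt
      apply hj
      have h1 : Q.coeff (j - F.natDegree) = 0 ∨ ¬ F.natDegree ≤ j := by
        by_cases hc : F.natDegree ≤ j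
        · exact .inl (coeff_eq_zero_of_lt_natTrailingDegree (by omega))
        · exact .inr hc
      have h2 : F.coeff (j - Q.natDegree) = 0 ∨ ¬ Q.natDegree ≤ j := by
        by_cases hc : Q.natDegree ≤ j
        · exact .inl (coeff_eq_zero_of_lt_natTrailingDegree (by omega))
        · exact .inr hc
      rcases h1 with h1 | h1 <;> rcases h2 with h2 | h2 <;> simp [h1, h2]
  have h1 := (hcoeff G.natDegree (leadingCoeff_ne_zero.2 hG0)).1
  have h2 := (hcoeff G.natTrailingDegree (trailingCoeff_nonzero_iff_nonzero.2 hG0)).2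
  omega

variable [IsDomain R]

/-- A divisor of a nonzero homogeneous element of an `ℕ`-graded domain is homogeneous. -/
theorem isHomogeneousElem_of_dvd {x y : R} (hy : SetLike.IsHomogeneousElem ℬ y) (hy0 : y ≠ 0)
    (h : x ∣ y) : SetLike.IsHomogeneousElem ℬ x := by
  obtain ⟨w, rfl⟩ := h
  obtain ⟨D, hD⟩ := hy
  have hx0 := toPolynomial_ne_zero ℬ (left_ne_zero_of_mul hy0)
  have hw0 := toPolynomial_ne_zero ℬ (right_ne_zero_of_mul hy0)
  have hm := toPolynomial_of_mem ℬ hD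
  have h1 := natDegree_mul hx0 hw0
  have h2 := natTrailingDegree_mul hx0 hw0
  rw [← map_mul, hm, natDegree_monomial_eq _ hy0] at h1
  rw [← map_mul, hm, natTrailingDegree_monomial hy0] at h2
  have h3 := natTrailingDegree_le_natDegree (toPolynomial ℬ x)
  have h4 := natTrailingDegree_le_natDegree (toPolynomial ℬ w)
  set i := (toPolynomial ℬ x).natDegree with hi
  refine ⟨i, ?_⟩
  have hx : x = (toPolynomial ℬ x).coeff i := by
    apply toPolynomial_injective ℬ
    rw [toPolynomial_of_mem ℬ (coeff_toPolynomial_mem ℬ x i)]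
    ext j
    rw [coeff_monomial]
    split_ifs with hij
    · rw [hij]
    · rcases lt_or_gt_of_ne hij with hlt | hgt
      · exact coeff_eq_zero_of_natDegree_lt hlt
      · exact coeff_eq_zero_of_lt_natTrailingDegree (by omega)
  rw [hx]
  exact coeff_toPolynomial_mem ℬ x i

/-- Every nonzero ideal of an `ℕ`-graded domain becomes principal when all nonzero homogeneous
elements are inverted. -/
theorem exists_generator_up_to_homogeneous {I : Ideal R} (hI : I ≠ ⊥) :
    ∃ f ∈ I, f ≠ 0 ∧ ∀ q ∈ I, ∃ t : R, SetLike.IsHomogeneousElem ℬ t ∧ t ≠ 0 ∧ f ∣ t * q := by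
  classical
  obtain ⟨f₀, hf₀, hf₀0⟩ := (Submodule.ne_bot_iff _).1 hI
  have hex : ∃ w, ∃ f ∈ I, f ≠ 0 ∧ width ℬ f = w := ⟨_, f₀, hf₀, hf₀0, rfl⟩
  obtain ⟨f, hf, hf0, hfw⟩ := Nat.find_spec hex
  have hmin : ∀ q ∈ I, q ≠ 0 → width ℬ f ≤ width ℬ q := fun q hq hq0 => by
    rw [hfw]; exact Nat.find_min' hex ⟨q, hq, hq0, rfl⟩
  refine ⟨f, hf, hf0, fun q hq => ?_⟩
  induction hw : width ℬ q using Nat.strong_induction_on generalizing q with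
  | _ w ih =>
    by_cases hq0 : q = 0
    · exact ⟨1, ⟨0, SetLike.GradedOne.one_mem⟩, one_ne_zero, by simp [hq0]⟩
    obtain ⟨a, b, hb, hb0, hlt⟩ := exists_width_lt ℬ hf0 hq0 (hmin q hq hq0)
    rcases hlt with h0 | hlt
    · exact ⟨b, hb, hb0, a, by rw [sub_eq_zero.1 h0, mul_comm]⟩
    · obtain ⟨t, ht, ht0, htd⟩ := ih _ (hw ▸ hlt) _
        (I.sub_mem (I.mul_mem_left b hq) (I.mul_mem_left a hf)) rfl
      refine ⟨t * b, SetLike.IsHomogeneousElem.mul ht hb, mul_ne_zero ht0 hb0, ?_⟩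
      have : t * b * q = t * (b * q - a * f) + t * a * f := by ring
      rw [this]
      exact dvd_add htd (dvd_mul_left _ _)

/-- The divisor class group of an `ℕ`-graded Noetherian domain is generated by the classes of the
height-one primes containing a nonzero homogeneous element. -/
theorem closure_toClass_eq_top [IsNoetherianRing R] :
    AddSubgroup.closure {c : DivisorClassGroup R | ∃ P : PrimeDivisor R,
      (∃ t ∈ P.asIdeal, SetLike.IsHomogeneousElem ℬ t ∧ t ≠ 0) ∧ P.toClass = c} = ⊤ := by
  classical
  set S : AddSubgroup (DivisorClassGroup R) := AddSubgroup.closure _ with hS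
  have hprime : ∀ Q : PrimeDivisor R, Q.toClass ∈ S := by
    intro Q
    by_cases hQ : ∃ t ∈ Q.asIdeal, SetLike.IsHomogeneousElem ℬ t ∧ t ≠ 0
    · exact AddSubgroup.subset_closure ⟨Q, hQ, rfl⟩
    obtain ⟨f, hf, hf0, hgen⟩ := exists_generator_up_to_homogeneous ℬ Q.ne_bot
    have hord : Q.ord f = 1 := PrimeDivisor.ord_eq_one hf fun q hq => by
      obtain ⟨t, ht, ht0, hd⟩ := hgen q hq
      exact ⟨t, fun htQ => hQ ⟨t, htQ, ht, ht0⟩, hd⟩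
    have hother : ∀ P : PrimeDivisor R, P ≠ Q → P.ord f ≠ 0 → P.toClass ∈ S := by
      intro P hPQ hP
      by_contra hPS
      have hPt : ∀ t ∈ P.asIdeal, SetLike.IsHomogeneousElem ℬ t → t = 0 := fun t htP ht => by
        by_contra ht0
        exact hPS (AddSubgroup.subset_closure ⟨P, ⟨t, htP, ht, ht0⟩, rfl⟩)
      have hfP : f ∈ P.asIdeal := by
        by_contra hfP
        exact hP (PrimeDivisor.ord_eq_zero hfP)
      refine hPQ (PrimeDivisor.ext_asIdeal (PrimeDivisor.eq_of_le Q.ne_bot fun q hq => ?_).symm)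
      obtain ⟨t, ht, ht0, hd⟩ := hgen q hq
      exact (P.isPrime.mem_or_mem (Ideal.mem_of_dvd _ hd hfP)).resolve_left
        fun htP => ht0 (hPt t htP ht)
    have hdiv : (Finsupp.single Q 1 : WeilDivisor R) =
        WeilDivisor.div f hf0 - (WeilDivisor.div f hf0).erase Q := by
      rw [eq_sub_iff_add_eq]
      conv_rhs => rw [← Finsupp.single_add_erase Q (WeilDivisor.div f hf0)]
      congr 2
      simp [WeilDivisor.div, Finsupp.ofSupportFinite_coe, hord]
    have hcl : Q.toClass = -QuotientAddGroup.mk ((WeilDivisor.div f hf0).erase Q) := by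
      rw [PrimeDivisor.toClass, hdiv, QuotientAddGroup.mk_sub, PrimeDivisor.mk_div, zero_sub]
    rw [hcl]
    refine S.neg_mem ?_
    rw [← Finsupp.sum_single ((WeilDivisor.div f hf0).erase Q), Finsupp.sum,
      ← QuotientAddGroup.mk'_apply, map_sum]
    refine S.sum_mem fun P hP => ?_
    rw [Finsupp.support_erase, Finset.mem_erase, Finsupp.mem_support_iff] at hP
    rw [← mul_one (Finsupp.erase Q _ P), ← smul_eq_mul, ← Finsupp.smul_single, map_zsmul]
    refine S.zsmul_mem (hother P hP.1 ?_) _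
    simpa [WeilDivisor.div, Finsupp.ofSupportFinite_coe] using hP.2
  rw [eq_top_iff]
  rintro ⟨D⟩ -
  change QuotientAddGroup.mk' _ D ∈ S
  rw [← Finsupp.sum_single D, Finsupp.sum, map_sum]
  refine S.sum_mem fun P _ => ?_
  rw [← mul_one (D P), ← smul_eq_mul, ← Finsupp.smul_single, map_zsmul]
  exact S.zsmul_mem (hprime P) _

end GradedRing

namespace IsAdjoinRootMonic

open DirectSum Polynomial

variable {A B σ : Type*} [CommRing A] [CommRing B] [Algebra A B]

section Grading

variable [SetLike σ A] (n m : ℕ) (𝒜 : ℕ → σ) (z : B)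

/-- The additive subgroups of the elements of degree `D` of an `A`-algebra generated by `z`, where
`z` has degree `m` and homogeneous elements of `A` of degree `e` have degree `n * e`. -/
def grading (D : ℕ) : AddSubgroup B :=
  AddSubgroup.closure
    {u | ∃ j e : ℕ, ∃ a ∈ 𝒜 e, j * m + n * e = D ∧ u = algebraMap A B a * z ^ j}

variable {𝒜} in
theorem algebraMap_mul_pow_mem_grading {a : A} {e : ℕ} (ha : a ∈ 𝒜 e) (j : ℕ) :
    algebraMap A B a * z ^ j ∈ grading n m 𝒜 z (j * m + n * e) :=
  AddSubgroup.subset_closure ⟨j, e, a, ha, rfl, rfl⟩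

variable {𝒜} in
theorem algebraMap_mem_grading {a : A} {e : ℕ} (ha : a ∈ 𝒜 e) :
    algebraMap A B a ∈ grading n m 𝒜 z (n * e) := by
  simpa using algebraMap_mul_pow_mem_grading n m z ha 0

variable {n m 𝒜 z} in
theorem directSum_of_congr {D E : ℕ} {u v : B} (hu : u ∈ grading n m 𝒜 z D)
    (hv : v ∈ grading n m 𝒜 z E) (hDE : D = E) (huv : u = v) :
    DirectSum.of (fun i => grading n m 𝒜 z i) D ⟨u, hu⟩ =
      DirectSum.of (fun i => grading n m 𝒜 z i) E ⟨v, hv⟩ := by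
  subst hDE huv
  rfl

variable [AddSubgroupClass σ A] [GradedRing 𝒜]

theorem mem_grading : z ∈ grading n m 𝒜 z m := by
  simpa using algebraMap_mul_pow_mem_grading n m z (𝒜 := 𝒜) (SetLike.GradedOne.one_mem) 1

instance : SetLike.GradedMonoid (grading n m 𝒜 z) where
  one_mem := by
    simpa using algebraMap_mem_grading n m z (𝒜 := 𝒜) (SetLike.GradedOne.one_mem)
  mul_mem := by
    intro i j x y hx hy
    induction hx using AddSubgroup.closure_induction with
    | mem x hx =>
      induction hy using AddSubgroup.closure_induction with
      | mem y hy =>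
        obtain ⟨j₁, e₁, a₁, ha₁, rfl, rfl⟩ := hx
        obtain ⟨j₂, e₂, a₂, ha₂, rfl, rfl⟩ := hy
        have := algebraMap_mul_pow_mem_grading n m z (SetLike.GradedMul.mul_mem ha₁ ha₂) (j₁ + j₂)
        have hdeg : j₁ * m + n * e₁ + (j₂ * m + n * e₂) = (j₁ + j₂) * m + n * (e₁ + e₂) := by ring
        rwa [hdeg, mul_mul_mul_comm, ← map_mul, ← pow_add]
      | zero => simp
      | add _ _ _ _ h₁ h₂ => rw [mul_add]; exact add_mem h₁ h₂
      | neg _ _ h => rw [mul_neg]; exact neg_mem h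
    | zero => simp
    | add _ _ _ _ h₁ h₂ => rw [add_mul]; exact add_mem h₁ h₂
    | neg _ _ h => rw [neg_mul]; exact neg_mem h

/-- The decomposition of the elements of `A` into homogeneous elements of `B`. -/
noncomputable def decomposeAlgebraMap : A →+* ⨁ i, grading n m 𝒜 z i :=
  (DirectSum.toSemiring
    (fun e => (DirectSum.of (fun i => grading n m 𝒜 z i) (n * e)).comp
      (((algebraMap A B).toAddMonoidHom.comp (AddSubmonoidClass.subtype (𝒜 e))).codRestrict
        (grading n m 𝒜 z (n * e)) fun a => algebraMap_mem_grading n m z a.2))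
    (directSum_of_congr _ _ (Nat.mul_zero n) (map_one (algebraMap A B)))
    (fun {i j} a b => by
      refine Eq.trans ?_ (DirectSum.of_mul_of (A := fun i => grading n m 𝒜 z i) _ _).symm
      exact directSum_of_congr _ _ (Nat.mul_add n i j) (map_mul (algebraMap A B) _ _))).comp
  (decomposeRingEquiv 𝒜).toRingHom

theorem decomposeAlgebraMap_apply {e : ℕ} {a : A} (ha : a ∈ 𝒜 e) :
    decomposeAlgebraMap n m 𝒜 z a = DirectSum.of (fun i => grading n m 𝒜 z i) (n * e)
      ⟨algebraMap A B a, algebraMap_mem_grading n m z ha⟩ := by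
  lift a to 𝒜 e using ha
  have h : decomposeRingEquiv 𝒜 (a : A) = DirectSum.of (fun i => 𝒜 i) e a := decompose_coe 𝒜 a
  simp only [decomposeAlgebraMap, RingHom.comp_apply, RingEquiv.toRingHom_eq_coe,
    RingHom.coe_coe, h]
  exact DirectSum.toSemiring_of (A := fun i => 𝒜 i) _ _ _ e a

end Grading

variable {n : ℕ} {g : A} (H : IsAdjoinRootMonic B (X ^ n - C g))

theorem root_pow : H.root ^ n = algebraMap A B g := by
  have := H.aeval_root_self
  rwa [map_sub, map_pow, aeval_X, aeval_C, sub_eq_zero] at this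

variable [SetLike σ A] [AddSubgroupClass σ A] {m : ℕ} (𝒜 : ℕ → σ) [GradedRing 𝒜]

theorem eval₂_decomposeAlgebraMap (hg : g ∈ 𝒜 m) :
    (X ^ n - C g).eval₂ (decomposeAlgebraMap n m 𝒜 H.root)
      (DirectSum.of (fun i => grading n m 𝒜 H.root i) m ⟨H.root, mem_grading n m 𝒜 H.root⟩) =
      0 := by
  rw [eval₂_sub, eval₂_X_pow, eval₂_C, sub_eq_zero, decomposeAlgebraMap_apply n m 𝒜 _ hg,
    DirectSum.ofPow]
  exact directSum_of_congr _ _ (by simp) H.root_pow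

/-- If `g ∈ A` is homogeneous, the `A`-algebra obtained by adjoining an `n`-th root of `g` is
graded. -/
@[reducible]
noncomputable def gradedRing (hg : g ∈ 𝒜 m) : GradedRing (grading n m 𝒜 H.root) where
  decompose' := H.lift _ _ (H.eval₂_decomposeAlgebraMap 𝒜 hg)
  left_inv := by
    intro x
    change (DirectSum.coeRingHom (grading n m 𝒜 H.root)).comp
      (H.lift _ _ (H.eval₂_decomposeAlgebraMap 𝒜 hg)) x = x
    refine (H.apply_eq_lift H.aeval_root_self _ (fun a => ?_) ?_ x).trans (H.lift_self_apply x)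
    · rw [RingHom.comp_apply, IsAdjoinRoot.lift_algebraMap]
      induction a using DirectSum.Decomposition.inductionOn 𝒜 with
      | zero => simp
      | homogeneous a =>
        rw [decomposeAlgebraMap_apply n m 𝒜 _ a.2, DirectSum.coeRingHom_of]
        rfl
      | add a b ha hb => rw [map_add, map_add, map_add, ha, hb]
    · rw [RingHom.comp_apply, IsAdjoinRoot.lift_root, DirectSum.coeRingHom_of]
  right_inv := by
    intro x
    induction x using DirectSum.induction_on with
    | zero => simp
    | add x y hx hy => rw [map_add, map_add, hx, hy]
    | of i x =>
      rw [DirectSum.coeAddMonoidHom_of]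
      obtain ⟨x, hx⟩ := x
      change H.lift _ _ _ x = _
      induction hx using AddSubgroup.closure_induction with
      | mem x hx =>
        obtain ⟨j, e, a, ha, rfl, rfl⟩ := hx
        rw [map_mul, map_pow, IsAdjoinRoot.lift_algebraMap, IsAdjoinRoot.lift_root,
          decomposeAlgebraMap_apply n m 𝒜 _ ha, DirectSum.ofPow, DirectSum.of_mul_of]
        exact directSum_of_congr _ _ (by simp [add_comm]) rfl
      | zero =>
        rw [map_zero]
        exact (map_zero (DirectSum.of (fun i => grading n m 𝒜 H.root i) i)).symm
      | add x y hx hy h₁ h₂ =>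
        rw [map_add, h₁, h₂]
        exact (map_add (DirectSum.of (fun i => grading n m 𝒜 H.root i) i) ⟨x, hx⟩ ⟨y, hy⟩).symm
      | neg x hx h =>
        rw [map_neg, h]
        exact (map_neg (DirectSum.of (fun i => grading n m 𝒜 H.root i) i) ⟨x, hx⟩).symm

variable {𝒜}

/-- When the degree of `g` is coprime to `n`, every homogeneous element is the product of a
homogeneous element of `A` and a power of the root. -/
theorem exists_eq_algebraMap_mul_root_pow (hn : 1 ≤ n) (hmn : Nat.Coprime m n) (hg : g ∈ 𝒜 m)
    {u : B} (hu : SetLike.IsHomogeneousElem (grading n m 𝒜 H.root) u) :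
    ∃ (j : ℕ) (a : A), SetLike.IsHomogeneousElem 𝒜 a ∧ u = algebraMap A B a * H.root ^ j := by
  obtain ⟨D, hu⟩ := hu
  have key : u = 0 ∨ ∃ j < n, ∃ e, ∃ a ∈ 𝒜 e, j * m + n * e = D ∧
      u = algebraMap A B a * H.root ^ j := by
    induction hu using AddSubgroup.closure_induction with
    | mem u hu =>
      obtain ⟨j, e, a, ha, hD, rfl⟩ := hu
      refine .inr ⟨j % n, Nat.mod_lt _ hn, e + (j / n) • m, a * g ^ (j / n),
        SetLike.GradedMul.mul_mem ha (SetLike.pow_mem_graded _ hg), ?_, ?_⟩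
      · rw [← hD]
        conv_rhs => rw [← Nat.mod_add_div j n]
        rw [smul_eq_mul]
        ring
      · conv_lhs => rw [← Nat.mod_add_div j n]
        rw [pow_add, pow_mul, H.root_pow, map_mul, map_pow]
        ring
    | zero => exact .inl rfl
    | add u v _ _ hu hv =>
      rcases hu with rfl | ⟨j₁, hj₁, e₁, a₁, ha₁, hD₁, rfl⟩
      · simpa using hv
      rcases hv with rfl | ⟨j₂, hj₂, e₂, a₂, ha₂, hD₂, rfl⟩
      · exact .inr ⟨j₁, hj₁, e₁, a₁, ha₁, hD₁, by simp⟩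
      have hj : j₁ = j₂ := by
        have h1 : j₁ * m ≡ j₂ * m [MOD n] := by
          have h2 : j₁ * m + n * e₁ ≡ j₂ * m + n * e₂ [MOD n] := by rw [hD₁, hD₂]
          simpa [Nat.ModEq] using h2
        have h3 := Nat.ModEq.cancel_right_of_coprime hmn.symm h1
        rwa [Nat.ModEq, Nat.mod_eq_of_lt hj₁, Nat.mod_eq_of_lt hj₂] at h3
      subst hj
      have he : e₁ = e₂ := Nat.eq_of_mul_eq_mul_left hn (by omega)
      subst he
      exact .inr ⟨j₁, hj₁, e₁, a₁ + a₂, add_mem ha₁ ha₂, hD₁, by rw [map_add, add_mul]⟩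
    | neg u _ hu =>
      rcases hu with rfl | ⟨j, hj, e, a, ha, hD, rfl⟩
      · exact .inl neg_zero
      · exact .inr ⟨j, hj, e, -a, neg_mem ha, hD, by rw [map_neg, neg_mul]⟩
  rcases key with rfl | ⟨j, -, e, a, ha, -, rfl⟩
  · exact ⟨0, 0, ⟨0, zero_mem _⟩, by simp⟩
  · exact ⟨j, a, ⟨e, ha⟩, rfl⟩

end IsAdjoinRootMonic

theorem UniqueFactorizationMonoid.exists_prime_dvd_mem {A : Type*} [CommRing A] [IsDomain A]
    [UniqueFactorizationMonoid A] {I : Ideal A} [I.IsPrime] {a : A} (ha : a ≠ 0) (haI : a ∈ I) :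
    ∃ p, Prime p ∧ p ∣ a ∧ p ∈ I := by
  obtain ⟨f, hf, u, hu⟩ := UniqueFactorizationMonoid.exists_prime_factors a ha
  have hfI : f.prod ∈ I := by
    rw [← hu] at haI
    exact (Ideal.mul_unit_mem_iff_mem I u.isUnit).1 haI
  obtain ⟨p, hpf, hpI⟩ := (Ideal.IsPrime.multiset_prod_mem_iff_exists_mem inferInstance f).1 hfI
  exact ⟨p, hf p hpf, (Multiset.dvd_prod hpf).trans ⟨u, hu.symm⟩, hpI⟩

namespace IsAdjoinRootMonic

open Polynomial

variable {A B σ : Type*} [CommRing A] [CommRing B] [IsDomain B] [Algebra A B]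
  {n : ℕ} {g : A} (H : IsAdjoinRootMonic B (X ^ n - C g))

include H in
theorem dvd_of_algebraMap_dvd {p c : A} (h : algebraMap A B p ∣ algebraMap A B c) : p ∣ c := by
  obtain ⟨y, hy⟩ := h
  refine ⟨H.coeff y 0, ?_⟩
  have := congrFun (congrArg H.coeff hy) 0
  rw [H.coeff_algebraMap, ← Algebra.smul_def, map_smul] at this
  simpa using this

include H in
theorem algebraMap_injective : Function.Injective (algebraMap A B) := by
  intro a b hab
  have := congrFun (congrArg H.coeff hab) 0
  rw [H.coeff_algebraMap, H.coeff_algebraMap] at this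
  simpa using this

include H in
theorem algebraMap_ne_zero {a : A} (ha : a ≠ 0) : algebraMap A B a ≠ 0 := by
  rwa [Ne, map_eq_zero_iff _ H.algebraMap_injective]

variable [IsDomain A]

include H in
theorem one_le : 1 ≤ n := by
  have := H.deg_pos
  rwa [natDegree_X_pow_sub_C] at this

theorem root_ne_zero (hg0 : g ≠ 0) : H.root ≠ 0 := by
  intro h
  apply H.algebraMap_ne_zero hg0
  rw [← H.root_pow, h, zero_pow (by have := H.one_le; omega)]

theorem isUnit_of_algebraMap_dvd_root_pow {p : A} (h : algebraMap A B p ∣ H.root ^ (n - 1)) :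
    IsUnit p := by
  obtain ⟨y, hy⟩ := h
  have h1 := H.one_le
  have := congrFun (congrArg H.coeff hy) (n - 1)
  rw [H.coeff_root_pow (by rw [natDegree_X_pow_sub_C]; omega), ← Algebra.smul_def,
    map_smul] at this
  exact IsUnit.of_mul_eq_one _ (by simpa using this.symm)

include H in
/-- If `B` is integrally closed and `n ≥ 2`, then `g` is squarefree. -/
theorem isUnit_of_mul_self_dvd [IsIntegrallyClosed B] (hn : 2 ≤ n) {p : A} (h : p * p ∣ g) :
    IsUnit p := by
  apply H.isUnit_of_algebraMap_dvd_root_pow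
  rw [← IsIntegrallyClosed.pow_dvd_pow_iff (n := n) (by omega), ← pow_mul, mul_comm, pow_mul,
    H.root_pow, ← map_pow, ← map_pow]
  refine _root_.map_dvd _ (dvd_trans ?_ (pow_dvd_pow_of_dvd h (n - 1)))
  rw [← pow_two, ← pow_mul]
  exact pow_dvd_pow _ (by omega)

include H in
theorem not_mul_self_dvd [IsIntegrallyClosed B] (hn : 2 ≤ n) {p : A} (hp : Prime p) :
    ¬ p * p ∣ g :=
  fun h => hp.not_isUnit (H.isUnit_of_mul_self_dvd hn h)

section RootDivisor

variable {p : A}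

/-- The reduction `B → A / (p)` sending the root to zero, for a divisor `p` of `g`. -/
noncomputable def residue (hpg : p ∣ g) : B →+* A ⧸ Ideal.span {p} :=
  H.lift (Ideal.Quotient.mk _) 0 (by
    rw [eval₂_sub, eval₂_X_pow, eval₂_C, zero_pow (by have := H.one_le; omega), zero_sub,
      neg_eq_zero, Ideal.Quotient.eq_zero_iff_mem, Ideal.mem_span_singleton]
    exact hpg)

theorem residue_algebraMap (hpg : p ∣ g) (a : A) :
    H.residue hpg (algebraMap A B a) = Ideal.Quotient.mk _ a :=
  IsAdjoinRoot.lift_algebraMap _ _ _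

theorem residue_root (hpg : p ∣ g) : H.residue hpg H.root = 0 :=
  IsAdjoinRoot.lift_root _ _

theorem ker_residue (hpg : p ∣ g) :
    RingHom.ker (H.residue hpg) = Ideal.span {H.root, algebraMap A B p} := by
  apply le_antisymm
  · intro x hx
    obtain ⟨F, rfl⟩ := H.map_surjective x
    have hF : H.map F = H.root * H.map F.divX + algebraMap A B (F.coeff 0) := by
      conv_lhs => rw [← X_mul_divX_add F]
      rw [map_add, map_mul, H.map_X, ← H.algebraMap_apply]
    rw [RingHom.mem_ker, hF, map_add, map_mul, residue_root, zero_mul, zero_add,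
      residue_algebraMap, Ideal.Quotient.eq_zero_iff_mem, Ideal.mem_span_singleton] at hx
    obtain ⟨c, hc⟩ := hx
    rw [hF, hc, map_mul]
    exact Ideal.add_mem _ (Ideal.mul_mem_right _ _ (Ideal.subset_span (by simp)))
      (Ideal.mul_mem_right _ _ (Ideal.subset_span (by simp)))
  · rw [Ideal.span_le]
    rintro _ (rfl | rfl)
    · exact H.residue_root hpg
    · rw [SetLike.mem_coe, RingHom.mem_ker, residue_algebraMap, Ideal.Quotient.eq_zero_iff_mem]
      exact Ideal.mem_span_singleton_self p

theorem algebraMap_mem_span_iff (hpg : p ∣ g) {a : A} :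
    algebraMap A B a ∈ Ideal.span {H.root, algebraMap A B p} ↔ p ∣ a := by
  rw [← H.ker_residue hpg, RingHom.mem_ker, residue_algebraMap, Ideal.Quotient.eq_zero_iff_mem,
    Ideal.mem_span_singleton]

theorem isPrime_span_root (hp : Prime p) (hpg : p ∣ g) :
    (Ideal.span {H.root, algebraMap A B p}).IsPrime := by
  rw [← H.ker_residue hpg]
  have : (Ideal.span {p}).IsPrime := (Ideal.span_singleton_prime hp.ne_zero).2 hp
  exact RingHom.ker_isPrime _

variable [UniqueFactorizationMonoid A]

theorem exists_span_root_le (hg0 : g ≠ 0) {Q : Ideal B} [Q.IsPrime] (hQ : H.root ∈ Q) :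
    ∃ p, Prime p ∧ p ∣ g ∧ Ideal.span {H.root, algebraMap A B p} ≤ Q := by
  have hgQ : g ∈ Q.comap (algebraMap A B) := by
    rw [Ideal.mem_comap, ← H.root_pow]
    exact Ideal.pow_mem_of_mem _ hQ _ H.one_le
  obtain ⟨p, hp, hpg, hpQ⟩ := UniqueFactorizationMonoid.exists_prime_dvd_mem hg0 hgQ
  refine ⟨p, hp, hpg, ?_⟩
  rw [Ideal.span_le]
  rintro _ (rfl | rfl)
  exacts [hQ, hpQ]

variable [IsNoetherianRing B]

/-- The height-one prime generated by the root and a prime divisor `p` of `g`. -/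
def rootDivisor (hg0 : g ≠ 0) (hp : Prime p) (hpg : p ∣ g) : PrimeDivisor B where
  asIdeal := Ideal.span {H.root, algebraMap A B p}
  isPrime := H.isPrime_span_root hp hpg
  height_eq_one := by
    have hprime := H.isPrime_span_root hp hpg
    apply le_antisymm
    · refine Ideal.height_le_one_of_isPrincipal_of_mem_minimalPrimes (Ideal.span {H.root}) _
        ⟨⟨hprime, Ideal.span_mono (by simp)⟩, ?_⟩
      rintro Q ⟨hQ, hrQ⟩ hQP
      have hrQ' : H.root ∈ Q := (Ideal.span_singleton_le_iff_mem _).1 hrQ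
      obtain ⟨q, hq, hqg, hqQ⟩ := H.exists_span_root_le hg0 hrQ'
      have hqQ' : algebraMap A B q ∈ Q := hqQ (Ideal.subset_span (by simp))
      have hpq : p ∣ q := (H.algebraMap_mem_span_iff hpg).1 (hQP hqQ')
      have hqp : q ∣ p := (hp.associated_of_dvd hq hpq).symm.dvd
      rw [Ideal.span_le]
      rintro _ (rfl | rfl)
      exacts [hrQ', Ideal.mem_of_dvd _ (_root_.map_dvd _ hqp) hqQ']
    · rw [Order.one_le_iff_ne_zero, Ne, Ideal.height_eq_zero_iff_eq_bot]
      intro hbot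
      have : H.root ∈ (⊥ : Ideal B) := hbot ▸ Ideal.subset_span (by simp)
      exact H.root_ne_zero hg0 (by simpa using this)

variable (hg0 : g ≠ 0) (hp : Prime p) (hpg : p ∣ g)

theorem root_mem_rootDivisor : H.root ∈ (H.rootDivisor hg0 hp hpg).asIdeal :=
  Ideal.subset_span (by simp)

theorem algebraMap_mem_rootDivisor {a : A} :
    algebraMap A B a ∈ (H.rootDivisor hg0 hp hpg).asIdeal ↔ p ∣ a :=
  H.algebraMap_mem_span_iff hpg

theorem exists_eq_rootDivisor {Q : PrimeDivisor B} (hQ : H.root ∈ Q.asIdeal) :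
    ∃ (q : A) (hq : Prime q) (hqg : q ∣ g), Q = H.rootDivisor hg0 hq hqg := by
  obtain ⟨q, hq, hqg, hle⟩ := H.exists_span_root_le hg0 hQ
  exact ⟨q, hq, hqg, PrimeDivisor.ext_asIdeal
    (PrimeDivisor.eq_of_le (H.rootDivisor hg0 hq hqg).ne_bot hle).symm⟩

theorem ord_root_rootDivisor (hsq : ¬ p * p ∣ g) : (H.rootDivisor hg0 hp hpg).ord H.root = 1 := by
  obtain ⟨c, hc⟩ := id hpg
  refine PrimeDivisor.ord_eq_one (H.root_mem_rootDivisor hg0 hp hpg) fun q hq =>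
    ⟨algebraMap A B c, ?_, ?_⟩
  · rw [algebraMap_mem_rootDivisor]
    exact fun h => hsq (hc ▸ mul_dvd_mul_left p h)
  · obtain ⟨x, y, rfl⟩ := Ideal.mem_span_pair.1 hq
    have : algebraMap A B c * (x * H.root + y * algebraMap A B p) =
        algebraMap A B c * x * H.root + y * H.root ^ n := by
      rw [H.root_pow, congrArg (algebraMap A B) hc, map_mul]
      ring
    rw [this]
    exact dvd_add (dvd_mul_left _ _)
      ((dvd_pow_self _ (by have := H.one_le; omega)).mul_left _)

theorem ord_algebraMap_self_rootDivisor (hsq : ¬ p * p ∣ g) :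
    (H.rootDivisor hg0 hp hpg).ord (algebraMap A B p) = n := by
  obtain ⟨c, hc⟩ := id hpg
  have hc0 : c ≠ 0 := by rintro rfl; exact hg0 (by simpa using hc)
  have h1 : (H.rootDivisor hg0 hp hpg).ord (algebraMap A B c) = 0 := by
    refine PrimeDivisor.ord_eq_zero ?_
    rw [algebraMap_mem_rootDivisor]
    exact fun h => hsq (hc ▸ mul_dvd_mul_left p h)
  have h2 := (H.rootDivisor hg0 hp hpg).ord_pow (H.root_ne_zero hg0) n
  rw [H.root_pow, ord_root_rootDivisor _ _ _ _ hsq] at h2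
  rw [congrArg (algebraMap A B) hc, map_mul, PrimeDivisor.ord_mul _ (H.algebraMap_ne_zero hp.ne_zero)
    (H.algebraMap_ne_zero hc0), h1] at h2
  simpa using h2

theorem dvd_ord_algebraMap_rootDivisor (hsq : ¬ p * p ∣ g) {a : A} (ha : a ≠ 0) :
    n ∣ (H.rootDivisor hg0 hp hpg).ord (algebraMap A B a) := by
  obtain ⟨e, c, hpc, rfl⟩ := WfDvdMonoid.max_power_factor ha hp.irreducible
  have hc0 : c ≠ 0 := right_ne_zero_of_mul ha
  rw [map_mul, map_pow, PrimeDivisor.ord_mul _ (pow_ne_zero _ (H.algebraMap_ne_zero hp.ne_zero))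
    (H.algebraMap_ne_zero hc0), PrimeDivisor.ord_pow _ (H.algebraMap_ne_zero hp.ne_zero),
    ord_algebraMap_self_rootDivisor _ _ _ _ hsq, PrimeDivisor.ord_eq_zero (a := algebraMap A B c)]
  · simp
  · rwa [algebraMap_mem_rootDivisor]

end RootDivisor

section Graded

variable [SetLike σ A] [AddSubgroupClass σ A] {m : ℕ} {𝒜 : ℕ → σ} [GradedRing 𝒜]

include H in
/-- A homogeneous prime element of `A` that does not divide `g` remains prime in `B`. -/
theorem isPrime_span_algebraMap (hmn : Nat.Coprime m n) (hg : g ∈ 𝒜 m) {p : A} (hp : Prime p)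
    (hpg : ¬ p ∣ g) (hph : SetLike.IsHomogeneousElem 𝒜 p) :
    (Ideal.span {algebraMap A B p}).IsPrime := by
  let := H.gradedRing 𝒜 hg
  have key : ∀ (c : A) (l : ℕ), algebraMap A B p ∣ algebraMap A B c * H.root ^ l → p ∣ c := by
    intro c l hd
    have h1 : algebraMap A B p ∣ algebraMap A B (c * g ^ l) := by
      rw [map_mul, map_pow, ← H.root_pow, ← pow_mul]
      refine hd.trans (mul_dvd_mul_left _ (pow_dvd_pow _ ?_))
      exact Nat.le_mul_of_pos_left l H.one_le
    exact (hp.dvd_or_dvd (H.dvd_of_algebraMap_dvd h1)).resolve_right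
      fun h => hpg (hp.dvd_of_dvd_pow h)
  apply Ideal.IsHomogeneous.isPrime_of_homogeneous_mem_or_mem (𝒜 := grading n m 𝒜 H.root)
  · apply Ideal.homogeneous_span
    rintro _ rfl
    obtain ⟨e, he⟩ := hph
    exact ⟨_, algebraMap_mem_grading n m H.root he⟩
  · rw [Ne, Ideal.span_singleton_eq_top]
    intro hu
    exact hp.not_isUnit (isUnit_of_dvd_one
      (H.dvd_of_algebraMap_dvd (by rw [map_one]; exact hu.dvd)))
  · intro x y hx hy hxy
    obtain ⟨i, a, -, rfl⟩ := H.exists_eq_algebraMap_mul_root_pow H.one_le hmn hg hx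
    obtain ⟨j, b, -, rfl⟩ := H.exists_eq_algebraMap_mul_root_pow H.one_le hmn hg hy
    rw [Ideal.mem_span_singleton] at hxy
    rw [mul_mul_mul_comm, ← map_mul, ← pow_add] at hxy
    refine (hp.dvd_or_dvd (key _ _ hxy)).imp ?_ ?_ <;> intro h <;>
      exact Ideal.mem_span_singleton.2 ((_root_.map_dvd _ h).mul_right _)

variable [UniqueFactorizationMonoid A] [IsNoetherianRing B] (hg0 : g ≠ 0)

/-- The divisor class group of `B` is generated by the primes containing the root. -/
theorem closure_rootDivisor_eq_top (hmn : Nat.Coprime m n) (hg : g ∈ 𝒜 m) :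
    AddSubgroup.closure {c : DivisorClassGroup B | ∃ (p : A) (hp : Prime p) (hpg : p ∣ g),
      (H.rootDivisor hg0 hp hpg).toClass = c} = ⊤ := by
  let := H.gradedRing 𝒜 hg
  rw [eq_top_iff, ← GradedRing.closure_toClass_eq_top (grading n m 𝒜 H.root),
    AddSubgroup.closure_le]
  rintro _ ⟨Q, ⟨t, htQ, ht, ht0⟩, rfl⟩
  have hroot : H.root ∈ Q.asIdeal → Q.toClass ∈ AddSubgroup.closure
      {c : DivisorClassGroup B | ∃ (p : A) (hp : Prime p) (hpg : p ∣ g),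
        (H.rootDivisor hg0 hp hpg).toClass = c} := by
    intro hQ
    obtain ⟨q, hq, hqg, rfl⟩ := H.exists_eq_rootDivisor hg0 hQ
    exact AddSubgroup.subset_closure ⟨q, hq, hqg, rfl⟩
  obtain ⟨j, a, ha, rfl⟩ := H.exists_eq_algebraMap_mul_root_pow H.one_le hmn hg ht
  have ha0 : a ≠ 0 := by rintro rfl; simp at ht0
  rcases Q.isPrime.mem_or_mem htQ with haQ | hzQ
  · have : a ∈ Q.asIdeal.comap (algebraMap A B) := haQ
    obtain ⟨p, hp, hpa, hpQ⟩ := UniqueFactorizationMonoid.exists_prime_dvd_mem ha0 this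
    rw [Ideal.mem_comap] at hpQ
    by_cases hpg : p ∣ g
    · refine hroot (Q.isPrime.mem_of_pow_mem n ?_)
      rw [H.root_pow]
      exact Ideal.mem_of_dvd _ (_root_.map_dvd _ hpg) hpQ
    · have hprime := H.isPrime_span_algebraMap hmn hg hp hpg
        (GradedRing.isHomogeneousElem_of_dvd 𝒜 ha ha0 hpa)
      have hQ : Ideal.span {algebraMap A B p} = Q.asIdeal :=
        PrimeDivisor.eq_of_le
          (by rw [Ne, Ideal.span_singleton_eq_bot]; exact H.algebraMap_ne_zero hp.ne_zero)
          ((Ideal.span_singleton_le_iff_mem _).2 hpQ)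
      rw [SetLike.mem_coe, Q.toClass_eq_zero hQ.symm]
      exact zero_mem _
  · exact hroot (Q.isPrime.mem_of_pow_mem j hzQ)

end Graded

end IsAdjoinRootMonic

namespace IsAdjoinRootMonic

open Polynomial

theorem factor_dvd {A : Type*} [CommRing A] {g : A} {r : ℕ} {h : Fin r → A}
    (hprod : g = ∏ i, h i) (i : Fin r) : h i ∣ g :=
  hprod ▸ Finset.dvd_prod_of_mem h (Finset.mem_univ i)

variable {A B σ : Type*} [CommRing A] [IsDomain A] [UniqueFactorizationMonoid A]
  [CommRing B] [IsDomain B] [IsNoetherianRing B] [Algebra A B]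
  {n : ℕ} {g : A} (H : IsAdjoinRootMonic B (X ^ n - C g)) (hg0 : g ≠ 0)
  {r : ℕ} {h : Fin r → A} (hp : ∀ i, Prime (h i)) (hprod : g = ∏ i, h i)

/-- The height-one prime generated by the root and the `i`-th factor of `g`. -/
def factorDivisor (i : Fin r) : PrimeDivisor B :=
  H.rootDivisor hg0 (hp i) (factor_dvd hprod i)

theorem exists_eq_factorDivisor {Q : PrimeDivisor B} (hQ : H.root ∈ Q.asIdeal) :
    ∃ i, Q = H.factorDivisor hg0 hp hprod i := by
  obtain ⟨q, hq, hqg, rfl⟩ := H.exists_eq_rootDivisor hg0 hQ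
  obtain ⟨i, -, hi⟩ := (Prime.dvd_finsetProd_iff hq h).1 (hprod ▸ hqg)
  refine ⟨i, PrimeDivisor.ext_asIdeal (PrimeDivisor.eq_of_le (PrimeDivisor.ne_bot _) ?_).symm⟩
  change Ideal.span _ ≤ _
  rw [Ideal.span_le]
  rintro _ (rfl | rfl)
  · exact hQ
  · exact (H.algebraMap_mem_rootDivisor hg0 hq hqg).2 hi

section Graded

variable [SetLike σ A] [AddSubgroupClass σ A] {m : ℕ} {𝒜 : ℕ → σ} [GradedRing 𝒜]

theorem closure_factorDivisor_eq_top (hmn : Nat.Coprime m n) (hg : g ∈ 𝒜 m) :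
    AddSubgroup.closure (Set.range fun i => (H.factorDivisor hg0 hp hprod i).toClass) = ⊤ := by
  rw [eq_top_iff, ← H.closure_rootDivisor_eq_top hg0 hmn hg]
  refine AddSubgroup.closure_mono ?_
  rintro _ ⟨q, hq, hqg, rfl⟩
  obtain ⟨i, hi⟩ := H.exists_eq_factorDivisor hg0 hp hprod (H.root_mem_rootDivisor hg0 hq hqg)
  exact ⟨i, by rw [hi]⟩

include H hg0 in
theorem subsingleton_divisorClassGroup (hn : n = 1) (hmn : Nat.Coprime m n) (hg : g ∈ 𝒜 m) :
    Subsingleton (DivisorClassGroup B) := by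
  have htop := H.closure_rootDivisor_eq_top hg0 hmn hg
  have hbot : AddSubgroup.closure {c : DivisorClassGroup B | ∃ (p : A) (hp : Prime p)
      (hpg : p ∣ g), (H.rootDivisor hg0 hp hpg).toClass = c} ≤ ⊥ := by
    rw [AddSubgroup.closure_le]
    rintro _ ⟨p, hp, hpg, rfl⟩
    refine PrimeDivisor.toClass_eq_zero _ (p := algebraMap A B p) ?_
    apply le_antisymm
    · change Ideal.span _ ≤ _
      rw [Ideal.span_le]
      rintro _ (rfl | rfl)
      · have hroot : H.root = algebraMap A B g := by
          rw [← H.root_pow, congrArg (H.root ^ ·) hn, pow_one]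
        rw [hroot]
        exact Ideal.mem_span_singleton.2 (_root_.map_dvd _ hpg)
      · exact Ideal.mem_span_singleton_self _
    · exact Ideal.span_mono (by simp)
  rw [htop] at hbot
  refine ⟨fun x y => ?_⟩
  have hx : x ∈ (⊥ : AddSubgroup _) := hbot trivial
  have hy : y ∈ (⊥ : AddSubgroup _) := hbot trivial
  rw [AddSubgroup.mem_bot] at hx hy
  rw [hx, hy]

end Graded

variable [IsIntegrallyClosed B] (hn : 2 ≤ n)

include H hn hp hprod

theorem factorDivisor_injective : Function.Injective (H.factorDivisor hg0 hp hprod) := by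
  intro i j hij
  by_contra hne
  have hmem : algebraMap A B (h i) ∈ (H.factorDivisor hg0 hp hprod j).asIdeal := by
    rw [← hij]
    exact (H.algebraMap_mem_rootDivisor hg0 (hp i) (factor_dvd hprod i)).2 dvd_rfl
  have hd : h j ∣ h i := (H.algebraMap_mem_rootDivisor hg0 (hp j) (factor_dvd hprod j)).1 hmem
  refine H.not_mul_self_dvd hn (hp j) ((mul_dvd_mul_right hd _).trans ?_)
  rw [hprod, ← Finset.mul_prod_erase Finset.univ h (Finset.mem_univ i)]
  exact mul_dvd_mul_left _ (Finset.dvd_prod_of_mem h (by simp [Ne.symm hne]))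

theorem ord_root_factorDivisor (i : Fin r) :
    (H.factorDivisor hg0 hp hprod i).ord H.root = 1 :=
  H.ord_root_rootDivisor hg0 (hp i) _ (H.not_mul_self_dvd hn (hp i))

theorem sum_toClass_factorDivisor :
    ∑ i, (H.factorDivisor hg0 hp hprod i).toClass = 0 := by
  classical
  rw [← PrimeDivisor.mk_div H.root (H.root_ne_zero hg0)]
  have hdiv : WeilDivisor.div H.root (H.root_ne_zero hg0) =
      ∑ i, Finsupp.single (H.factorDivisor hg0 hp hprod i) (1 : ℤ) := by
    ext Q
    rw [Finsupp.finsetSum_apply]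
    simp only [WeilDivisor.div, Finsupp.ofSupportFinite_coe]
    by_cases hQ : H.root ∈ Q.asIdeal
    · obtain ⟨i, rfl⟩ := H.exists_eq_factorDivisor hg0 hp hprod hQ
      rw [H.ord_root_factorDivisor hg0 hp hprod hn i, Finset.sum_eq_single i]
      · simp
      · intro j _ hj
        exact Finsupp.single_eq_of_ne
          fun e => hj (H.factorDivisor_injective hg0 hp hprod hn e.symm)
      · simp
    · rw [PrimeDivisor.ord_eq_zero hQ, Finset.sum_eq_zero]
      · simp
      · intro j _
        refine Finsupp.single_eq_of_ne ?_
        rintro rfl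
        exact hQ (H.root_mem_rootDivisor hg0 (hp j) (factor_dvd hprod j))
  rw [hdiv, ← QuotientAddGroup.mk'_apply, map_sum]
  rfl

theorem nsmul_toClass_factorDivisor (i : Fin r) :
    n • (H.factorDivisor hg0 hp hprod i).toClass = 0 := by
  classical
  have hi0 := H.algebraMap_ne_zero (hp i).ne_zero
  rw [← PrimeDivisor.mk_div _ hi0]
  have hdiv : WeilDivisor.div _ hi0 =
      n • Finsupp.single (H.factorDivisor hg0 hp hprod i) (1 : ℤ) := by
    ext Q
    simp only [WeilDivisor.div, Finsupp.ofSupportFinite_coe, Finsupp.smul_apply]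
    by_cases hQ : algebraMap A B (h i) ∈ Q.asIdeal
    · have hle : (H.factorDivisor hg0 hp hprod i).asIdeal ≤ Q.asIdeal := by
        change Ideal.span _ ≤ _
        rw [Ideal.span_le]
        rintro _ (rfl | rfl)
        · refine Q.isPrime.mem_of_pow_mem n ?_
          rw [H.root_pow]
          exact Ideal.mem_of_dvd _ (_root_.map_dvd _ (factor_dvd hprod i)) hQ
        · exact hQ
      obtain rfl := PrimeDivisor.ext_asIdeal (PrimeDivisor.eq_of_le (PrimeDivisor.ne_bot _) hle)
      have : (H.factorDivisor hg0 hp hprod i).ord (algebraMap A B (h i)) = n :=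
        H.ord_algebraMap_self_rootDivisor hg0 (hp i) _ (H.not_mul_self_dvd hn (hp i))
      rw [this]
      simp
    · rw [PrimeDivisor.ord_eq_zero hQ, Finsupp.single_eq_of_ne]
      · simp
      · rintro rfl
        exact hQ ((H.algebraMap_mem_rootDivisor hg0 (hp i) (factor_dvd hprod i)).2 dvd_rfl)
  rw [hdiv]
  rfl

section Graded

variable [SetLike σ A] [AddSubgroupClass σ A] {m : ℕ} {𝒜 : ℕ → σ} [GradedRing 𝒜]

/-- An element of `B` vanishing only along the primes containing the root vanishes to the same
order modulo `n` along all of these. -/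
theorem exists_modEq_ord (hmn : Nat.Coprime m n) (hg : g ∈ 𝒜 m) {u : B} (hu : u ≠ 0)
    (hord : ∀ Q : PrimeDivisor B, H.root ∉ Q.asIdeal → Q.ord u = 0) :
    ∃ t : ℕ, ∀ i, (H.factorDivisor hg0 hp hprod i).ord u ≡ t [MOD n] := by
  let := H.gradedRing 𝒜 hg
  have hz0 := H.root_ne_zero hg0
  set M := ∑ i, (H.factorDivisor hg0 hp hprod i).ord u with hM
  have hdvd : u ∣ H.root ^ M := by
    refine dvd_of_forall_ord_le (pow_ne_zero _ hz0) hu fun Q => ?_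
    by_cases hQ : H.root ∈ Q.asIdeal
    · obtain ⟨i, rfl⟩ := H.exists_eq_factorDivisor hg0 hp hprod hQ
      rw [PrimeDivisor.ord_pow _ hz0, H.ord_root_factorDivisor hg0 hp hprod hn i, mul_one, hM]
      exact Finset.single_le_sum (f := fun i => (H.factorDivisor hg0 hp hprod i).ord u)
        (fun _ _ => Nat.zero_le _) (Finset.mem_univ i)
    · rw [hord Q hQ]
      exact Nat.zero_le _
  have huh : SetLike.IsHomogeneousElem (grading n m 𝒜 H.root) u :=
    GradedRing.isHomogeneousElem_of_dvd _
      ⟨_, SetLike.pow_mem_graded M (mem_grading n m 𝒜 H.root)⟩ (pow_ne_zero _ hz0) hdvd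
  obtain ⟨j, a, -, rfl⟩ := H.exists_eq_algebraMap_mul_root_pow H.one_le hmn hg huh
  have ha0 : a ≠ 0 := by rintro rfl; simp at hu
  refine ⟨j, fun i => ?_⟩
  rw [PrimeDivisor.ord_mul _ (H.algebraMap_ne_zero ha0) (pow_ne_zero _ hz0),
    PrimeDivisor.ord_pow _ hz0, H.ord_root_factorDivisor hg0 hp hprod hn i, mul_one]
  obtain ⟨b, hb⟩ := H.dvd_ord_algebraMap_rootDivisor hg0 (hp i) (factor_dvd hprod i)
    (H.not_mul_self_dvd hn (hp i)) ha0
  rw [factorDivisor, hb, Nat.ModEq, Nat.mul_add_mod]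

/-- The coefficients of a linear relation between the classes of the primes containing the root
are all congruent modulo `n`. -/
theorem exists_dvd_sub_of_sum_zsmul_toClass_eq_zero (hmn : Nat.Coprime m n) (hg : g ∈ 𝒜 m)
    (c : Fin r → ℤ) (hc : ∑ i, c i • (H.factorDivisor hg0 hp hprod i).toClass = 0) :
    ∃ t : ℤ, ∀ i, (n : ℤ) ∣ c i - t := by
  classical
  have hz0 := H.root_ne_zero hg0
  set P := H.factorDivisor hg0 hp hprod with hP
  have hPinj : Function.Injective P := H.factorDivisor_injective hg0 hp hprod hn
  set D : WeilDivisor B := ∑ i, c i • Finsupp.single (P i) (1 : ℤ) with hD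
  have hDmem : D ∈ principalDivisors B := by
    rw [← QuotientAddGroup.eq_zero_iff, ← QuotientAddGroup.mk'_apply, hD, map_sum, ← hc]
    rfl
  obtain ⟨a, b, ha, hb, hab⟩ := hDmem
  have hDapply : ∀ Q, D Q = (Q.ord a : ℤ) - Q.ord b := fun Q => by
    rw [hab]
    simp [WeilDivisor.div, Finsupp.ofSupportFinite_coe]
  have hDP : ∀ i, D (P i) = c i := fun i => by
    rw [hD, Finsupp.finsetSum_apply, Finset.sum_eq_single i]
    · simp
    · intro j _ hj
      rw [Finsupp.smul_apply, Finsupp.single_eq_of_ne fun e => hj (hPinj e.symm), smul_zero]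
    · simp
  have hD0 : ∀ Q : PrimeDivisor B, H.root ∉ Q.asIdeal → D Q = 0 := fun Q hQ => by
    rw [hD, Finsupp.finsetSum_apply, Finset.sum_eq_zero]
    intro j _
    rw [Finsupp.smul_apply, Finsupp.single_eq_of_ne, smul_zero]
    rintro rfl
    exact hQ (H.root_mem_rootDivisor hg0 (hp j) (factor_dvd hprod j))
  set N := ∑ i, (c i).natAbs with hN
  have hNle : ∀ i, (c i).natAbs ≤ N := fun i =>
    Finset.single_le_sum (f := fun i => (c i).natAbs) (fun _ _ => Nat.zero_le _)
      (Finset.mem_univ i)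
  have hzN : ∀ i, (P i).ord (H.root ^ (n * N)) = n * N := fun i => by
    rw [PrimeDivisor.ord_pow _ hz0, H.ord_root_factorDivisor hg0 hp hprod hn i, mul_one]
  have hz : ∀ Q : PrimeDivisor B, H.root ∉ Q.asIdeal → Q.ord (H.root ^ (n * N)) = 0 :=
    fun Q hQ => by rw [PrimeDivisor.ord_pow _ hz0, PrimeDivisor.ord_eq_zero hQ, mul_zero]
  have hzN0 : H.root ^ (n * N) ≠ 0 := pow_ne_zero _ hz0
  have hdvd : b ∣ a * H.root ^ (n * N) := by
    refine dvd_of_forall_ord_le (mul_ne_zero ha hzN0) hb fun Q => ?_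
    rw [Q.ord_mul ha hzN0]
    have h1 := hDapply Q
    by_cases hQ : H.root ∈ Q.asIdeal
    · obtain ⟨i, rfl⟩ := H.exists_eq_factorDivisor hg0 hp hprod hQ
      rw [← hP] at h1 ⊢
      rw [hDP] at h1
      rw [hzN]
      have h2 := hNle i
      have h3 : N ≤ n * N := Nat.le_mul_of_pos_left N (by omega)
      omega
    · rw [hD0 Q hQ] at h1
      omega
  obtain ⟨u, hu⟩ := hdvd
  have hu0 : u ≠ 0 := by
    rintro rfl
    exact mul_ne_zero ha hzN0 (by simpa using hu)
  have hordu : ∀ Q : PrimeDivisor B, Q.ord a + Q.ord (H.root ^ (n * N)) = Q.ord b + Q.ord u :=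
    fun Q => by rw [← Q.ord_mul ha hzN0, hu, Q.ord_mul hb hu0]
  obtain ⟨t, ht⟩ := H.exists_modEq_ord hg0 hp hprod hn hmn hg hu0 fun Q hQ => by
    have h1 := hDapply Q
    have h2 := hordu Q
    rw [hz Q hQ] at h2
    rw [hD0 Q hQ] at h1
    omega
  refine ⟨t, fun i => ?_⟩
  have h1 := hDapply (P i)
  have h2 := hordu (P i)
  rw [hDP] at h1
  rw [hzN] at h2
  have h3 : (n : ℤ) ∣ t - (P i).ord u := Nat.modEq_iff_dvd.1 (ht i)
  have h4 : c i - t = -(t - (P i).ord u) + n * (-N : ℤ) := by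
    zify at h2
    rw [h1]
    linear_combination h2
  rw [h4]
  exact dvd_add (dvd_neg.2 h3) (dvd_mul_right _ _)

end Graded

end IsAdjoinRootMonic

namespace IsAdjoinRootMonic

open Polynomial

variable {A B σ : Type*} [CommRing A] [IsDomain A] [UniqueFactorizationMonoid A]
  [CommRing B] [IsDomain B] [IsNoetherianRing B] [Algebra A B]
  {n : ℕ} {g : A} (H : IsAdjoinRootMonic B (X ^ n - C g)) (hg0 : g ≠ 0)
  {s : ℕ} {h : Fin (s + 1) → A} (hp : ∀ i, Prime (h i)) (hprod : g = ∏ i, h i)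
  [IsIntegrallyClosed B] (hn : 2 ≤ n)
  [SetLike σ A] [AddSubgroupClass σ A] {m : ℕ} {𝒜 : ℕ → σ} [GradedRing 𝒜]

include hn in
/-- The divisor class group of `B` is free over `ℤ / n` on the classes of all but one of the primes
containing the root. -/
theorem exists_divisorClassGroup_equiv (hmn : Nat.Coprime m n) (hg : g ∈ 𝒜 m) :
    ∃ e : DivisorClassGroup B ≃+ (Fin s → ZMod n),
      ∀ i, e (H.factorDivisor hg0 hp hprod i.castSucc).toClass = Pi.single i 1 := by
  classical
  set P := H.factorDivisor hg0 hp hprod with hP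
  let φ : (Fin s → ℤ) →+ DivisorClassGroup B :=
    { toFun := fun c => ∑ i, c i • (P i.castSucc).toClass
      map_zero' := by simp
      map_add' := fun c d => by
        simp only [Pi.add_apply, add_zsmul, Finset.sum_add_distrib] }
  have hφ : ∀ c, φ c = ∑ i, c i • (P i.castSucc).toClass := fun _ => rfl
  have hφ1 : ∀ i, φ (Pi.single i 1) = (P i.castSucc).toClass := fun i => by
    rw [hφ, Finset.sum_eq_single i]
    · simp
    · intro j _ hj
      rw [Pi.single_eq_of_ne hj, zero_zsmul]
    · simp
  let ψ : (Fin s → ℤ) →+ (Fin s → ZMod n) := (Int.castAddHom (ZMod n)).compLeft (Fin s)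
  have hψ : ∀ c i, ψ c i = (c i : ZMod n) := fun _ _ => rfl
  have hφs : Function.Surjective φ := by
    rw [← AddMonoidHom.range_eq_top, eq_top_iff,
      ← H.closure_factorDivisor_eq_top hg0 hp hprod hmn hg, AddSubgroup.closure_le]
    have hmem : ∀ i : Fin s, (P i.castSucc).toClass ∈ φ.range := fun i => ⟨_, hφ1 i⟩
    rintro _ ⟨i, rfl⟩
    induction i using Fin.lastCases with
    | cast i => exact hmem i
    | last =>
      have hsum := H.sum_toClass_factorDivisor hg0 hp hprod hn
      rw [Fin.sum_univ_castSucc] at hsum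
      change (H.factorDivisor hg0 hp hprod (Fin.last s)).toClass ∈ φ.range
      rw [eq_neg_of_add_eq_zero_right hsum]
      exact neg_mem (sum_mem fun i _ => hmem i)
  have hψs : Function.Surjective ψ := fun y =>
    ⟨fun i => (ZMod.intCast_surjective (y i)).choose, funext fun i =>
      (ZMod.intCast_surjective (y i)).choose_spec⟩
  have hker : φ.ker = ψ.ker := by
    ext c
    rw [AddMonoidHom.mem_ker, AddMonoidHom.mem_ker]
    have hψ0 : ψ c = 0 ↔ ∀ i, (n : ℤ) ∣ c i := by
      rw [funext_iff]
      exact forall_congr' fun i => by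
        rw [hψ, Pi.zero_apply, ZMod.intCast_zmod_eq_zero_iff_dvd]
    rw [hψ0]
    constructor
    · intro h0
      obtain ⟨t, ht⟩ := H.exists_dvd_sub_of_sum_zsmul_toClass_eq_zero hg0 hp hprod hn hmn hg
        (Fin.snoc c 0) (by
          rw [hφ] at h0
          rw [Fin.sum_univ_castSucc]
          simpa using h0)
      have hlast := ht (Fin.last s)
      rw [Fin.snoc_last, zero_sub, dvd_neg] at hlast
      intro i
      have hi := ht i.castSucc
      rw [Fin.snoc_castSucc] at hi
      exact (dvd_sub_left hlast).1 hi
    · intro hdvd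
      rw [hφ]
      refine Finset.sum_eq_zero fun i _ => ?_
      obtain ⟨b, hb⟩ := hdvd i
      rw [hb, mul_comm, mul_smul, natCast_zsmul, H.nsmul_toClass_factorDivisor hg0 hp hprod hn,
        smul_zero]
  let e := (QuotientAddGroup.quotientKerEquivOfSurjective φ hφs).symm.trans
    ((QuotientAddGroup.quotientAddEquivOfEq hker).trans
      (QuotientAddGroup.quotientKerEquivOfSurjective ψ hψs))
  have he : ∀ c, e (φ c) = ψ c := fun c => by
    have h1 : (QuotientAddGroup.quotientKerEquivOfSurjective φ hφs).symm (φ c) =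
        QuotientAddGroup.mk c := by
      rw [AddEquiv.symm_apply_eq]
      rfl
    simp only [e, AddEquiv.trans_apply, h1]
    rfl
  refine ⟨e, fun i => ?_⟩
  rw [← hφ1, he]
  ext j
  rw [hψ, Pi.single_apply, Pi.single_apply]
  split_ifs <;> simp

end IsAdjoinRootMonic

theorem ZMod.closure_range_single (n s : ℕ) :
    AddSubgroup.closure (Set.range fun i : Fin s => (Pi.single i 1 : Fin s → ZMod n)) = ⊤ := by
  rw [eq_top_iff]
  intro x _
  rw [← Finset.univ_sum_single x]
  refine sum_mem fun i _ => ?_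
  obtain ⟨c, hc⟩ := ZMod.intCast_surjective (x i)
  have : Pi.single i (x i) = c • (Pi.single i 1 : Fin s → ZMod n) := by
    rw [← Pi.single_smul, zsmul_one, hc]
  rw [this]
  exact zsmul_mem (AddSubgroup.subset_closure (Set.mem_range_self i)) c

theorem ZMod.closure_single_image_ne_top {n s : ℕ} (hn : 2 ≤ n) {J : Set (Fin s)}
    (hJ : J ≠ Set.univ) :
    AddSubgroup.closure ((fun i : Fin s => (Pi.single i 1 : Fin s → ZMod n)) '' J) ≠ ⊤ := by
  obtain ⟨j, hj⟩ := (Set.ne_univ_iff_exists_notMem _).1 hJ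
  intro htop
  have hle : AddSubgroup.closure ((fun i : Fin s => (Pi.single i 1 : Fin s → ZMod n)) '' J) ≤
      (Pi.evalAddMonoidHom (fun _ : Fin s => ZMod n) j).ker := by
    rw [AddSubgroup.closure_le]
    rintro _ ⟨i, hi, rfl⟩
    have hji : j ≠ i := by
      rintro rfl
      exact hj hi
    exact Pi.single_eq_of_ne (M := fun _ => ZMod n) hji 1
  rw [htop] at hle
  have h1 : (Pi.single j 1 : Fin s → ZMod n) j = 0 := hle (AddSubgroup.mem_top (Pi.single j 1))
  rw [Pi.single_eq_same] at h1
  have : Fact (1 < n) := ⟨hn⟩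
  exact one_ne_zero h1

open Polynomial in
/-- The structure of the divisor class group of the normal domain obtained from a graded factorial
domain `A` by adjoining an `n`-th root of a homogeneous element `g` of degree prime to `n`. -/
theorem IsAdjoinRootMonic.divisorClassGroup_structure {A B σ : Type*} [CommRing A] [IsDomain A]
    [UniqueFactorizationMonoid A] [CommRing B] [IsDomain B] [IsNoetherianRing B]
    [IsIntegrallyClosed B] [Algebra A B] {n : ℕ} {g : A} (H : IsAdjoinRootMonic B (X ^ n - C g))
    [SetLike σ A] [AddSubgroupClass σ A] (𝒜 : ℕ → σ) [GradedRing 𝒜] {m : ℕ} (hg : g ∈ 𝒜 m)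
    (hmn : Nat.Coprime m n) {r : ℕ} {h : Fin r → A} (hirr : ∀ i, Irreducible (h i))
    (hprod : g = ∏ i, h i) :
    Nonempty (DivisorClassGroup B ≃+ (Fin (r - 1) → ZMod n)) ∧
    ∃ P : Fin r → PrimeDivisor B,
      (∀ i, (P i).asIdeal = Ideal.span {H.root, algebraMap A B (h i)}) ∧
      AddSubgroup.closure
        (Set.range fun i : Fin (r - 1) => (P (i.castLE (Nat.sub_le r 1))).toClass) = ⊤ ∧
      (2 ≤ n → ∀ J : Set (Fin (r - 1)), J ≠ Set.univ →
        AddSubgroup.closure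
          ((fun i : Fin (r - 1) => (P (i.castLE (Nat.sub_le r 1))).toClass) '' J) ≠ ⊤) := by
  have hg0 : g ≠ 0 := by
    rw [hprod]
    exact Finset.prod_ne_zero_iff.2 fun i _ => (hirr i).ne_zero
  have hp : ∀ i, Prime (h i) := fun i => (hirr i).prime
  have hideal : ∀ i, (H.factorDivisor hg0 hp hprod i).asIdeal =
      Ideal.span {H.root, algebraMap A B (h i)} := fun _ => rfl
  rcases H.one_le.eq_or_lt with hn1 | hn2
  · have hsub : Subsingleton (DivisorClassGroup B) :=
      H.subsingleton_divisorClassGroup hg0 hn1.symm hmn hg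
    have hZ : Subsingleton (ZMod n) := hn1 ▸ inferInstanceAs (Subsingleton (ZMod 1))
    have := uniqueOfSubsingleton (0 : DivisorClassGroup B)
    have := uniqueOfSubsingleton (0 : Fin (r - 1) → ZMod n)
    refine ⟨⟨AddEquiv.ofUnique⟩, H.factorDivisor hg0 hp hprod, hideal, ?_, fun h2 => by omega⟩
    exact Subsingleton.elim _ _
  · obtain _ | s := r
    · exfalso
      have h1 : (1 : A) ∈ 𝒜 m := by simpa [hprod] using hg
      have hm : m = 0 := DirectSum.degree_eq_of_mem_mem 𝒜 h1 SetLike.GradedOne.one_mem one_ne_zero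
      rw [hm, Nat.coprime_zero_left] at hmn
      omega
    · obtain ⟨e, he⟩ := H.exists_divisorClassGroup_equiv hg0 hp hprod hn2 hmn hg
      refine ⟨⟨e⟩, H.factorDivisor hg0 hp hprod, hideal, ?_, fun _ J hJ htop => ?_⟩
      · apply AddSubgroup.map_injective (f := e.toAddMonoidHom) e.injective
        rw [AddMonoidHom.map_closure, AddSubgroup.map_top_of_surjective _ e.surjective,
          ← Set.range_comp]
        exact (congrArg (fun f => AddSubgroup.closure (Set.range f)) (funext he)).trans
          (ZMod.closure_range_single n s)
      · refine ZMod.closure_single_image_ne_top (n := n) hn2 hJ ?_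
        have := congrArg (AddSubgroup.map e.toAddMonoidHom) htop
        rw [AddMonoidHom.map_closure, AddSubgroup.map_top_of_surjective _ e.surjective,
          ← Set.image_comp] at this
        exact (congrArg (fun f => AddSubgroup.closure (f '' J)) (funext he)).symm.trans this

/-- `k[z, x₁, …, x_d] / (zⁿ - g)` is obtained from `k[x₁, …, x_d]` by adjoining an `n`-th root. -/
noncomputable def Hypersurface.isAdjoinRootMonic {k : Type*} [Field k] {d : ℕ} {n : ℕ}
    (hn : 1 ≤ n) (g : MvPolynomial (Fin d) k) :
    IsAdjoinRootMonic (Hypersurface n g) (Polynomial.X ^ n - Polynomial.C g) where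
  map := Ideal.Quotient.mkₐ (MvPolynomial (Fin d) k) _
  map_surjective := Ideal.Quotient.mkₐ_surjective _ _
  ker_map := Ideal.Quotient.mkₐ_ker (MvPolynomial (Fin d) k) _
  monic := Polynomial.monic_X_pow_sub_C g (by omega)

theorem proposition3p1 {k : Type*} [Field k] {d : ℕ} (n : ℕ) (hn : 1 ≤ n)
    (g : MvPolynomial (Fin d) k)
    -- `R = k[z, x₁, …, x_d] / (zⁿ - g)` is a normal domain
    [IsDomain (Hypersurface n g)] [IsIntegrallyClosed (Hypersurface n g)]
    -- an `ℕ`-grading on `A = k[x₁, …, x_d]` with `A₀ = k`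
    (𝒜 : ℕ → Submodule k (MvPolynomial (Fin d) k)) [GradedAlgebra 𝒜]
    (h𝒜 : 𝒜 0 = LinearMap.range (Algebra.linearMap k (MvPolynomial (Fin d) k)))
    -- `g` is homogeneous of degree `m` coprime to `n`
    (m : ℕ) (hg : g ∈ 𝒜 m) (hmn : Nat.Coprime m n)
    -- the factorization `g = h₁ ⋯ h_r`
    (r : ℕ) (h : Fin r → MvPolynomial (Fin d) k) (hirr : ∀ i, Irreducible (h i))
    (hprod : g = ∏ i, h i) :
    Nonempty (DivisorClassGroup (Hypersurface n g) ≃+ (Fin (r - 1) → ZMod n)) ∧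
    ∃ P : Fin r → PrimeDivisor (Hypersurface n g),
      (∀ i, (P i).asIdeal = Ideal.span {Hypersurface.z n g, Hypersurface.of n g (h i)}) ∧
      -- the classes of the first `r - 1` of these primes generate `Cl(R)`
      AddSubgroup.closure
        (Set.range fun i : Fin (r - 1) => (P (i.castLE (Nat.sub_le r 1))).toClass) = ⊤ ∧
      -- and, for `n ≥ 2`, no proper subfamily does
      (2 ≤ n → ∀ J : Set (Fin (r - 1)), J ≠ Set.univ →
        AddSubgroup.closure
          ((fun i : Fin (r - 1) => (P (i.castLE (Nat.sub_le r 1))).toClass) '' J) ≠ ⊤) := by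
  obtain ⟨hCl, P, hP, hgen⟩ :=
    IsAdjoinRootMonic.divisorClassGroup_structure (A := MvPolynomial (Fin d) k)
      (B := Hypersurface n g) (n := n) (g := g) (σ := Submodule k (MvPolynomial (Fin d) k))
      (m := m) (r := r) (h := h) (Hypersurface.isAdjoinRootMonic hn g) 𝒜 hg hmn hirr hprod
  refine ⟨hCl, P, fun i => ?_, hgen⟩
  rw [hP i]
  rfl
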